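/- Let $\mathbb F$ be an algebraically closed field of characteristic $0$, $N\ge 1$, and $\mathbb F[N]$ the group of $N$-th roots of unity in $\mathbb F$. **The structure.** Let $\mathrm{QHO}_N$ be a set $L$ with a surjection $\pi:L\to\mathbb P=\mathbb F\cup\{\infty\}$, an action of $\mathbb F[N]$ on $L$ that is free and transitive on each fibre of $\pi$, and ternary relations $\mathbf A,\mathbf A^\dagger\subseteq L^2\times\mathbb F$ such that * for all $a\in\mathbb F$ and $e\in\pi^{-1}(a)$ there are $b\in\mathbb F$ and $e'\in\pi^{-1}(a+1)$ with $b^2=a$ and, for every $\gamma\in\mathbb F[N]$, $\mathbf A(\gamma e,\gamma e',b)$ and $\mathbf A^\dagger(\gamma e',\gamma e,b)$; * if $N$ is even, $\mathbf A(e,e',b)$ implies $\mathbf A(\gamma e,-\gamma e',-b)$ and $\mathbf A^\dagger(e',e,b)$ implies $\mathbf A^\dagger(\gamma e',-\gamma e,-b)$, for every $\gamma\in\mathbb F[N]$; * the maps $\mathbf a,\mathbf a^\dagger$ below are well defined: for $\pi(e)\in\mathbb F$, if $\mathbf A(e,e_1,b_1)$ and $\mathbf A(e,e_2,b_2)$,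 then $\gamma e_1=e_2$ and $\gamma^{-1}b_1=b_2$ for some $\gamma\in\mathbb F[N]$; likewise for $\mathbf A^\dagger$. Let $\mathcal H$ be the set of classes of pairs $(e,x)$, $e\in L$, $\pi(e)\in\mathbb F$, $x\in\mathbb F$, where $(e,x)\sim(e',x')$ iff $\gamma e=e'$ and $\gamma^{-1}x=x'$ for some $\gamma\in\mathbb F[N]$. Put $\mathbf p(e,x)=\pi(e)$ and $\lambda(e,x)=(e,\lambda x)$. Let $\mathbf a,\mathbf a^\dagger:\mathcal H\to\mathcal H$ be the maps, linear on the fibres of $\mathbf p$, with $\mathbf a(e,1)=(e',b)$ where $\mathbf A(e,e',b)$, and $\mathbf a^\dagger(e',1)=(e,b)$ where $\mathbf A^\dagger(e',e,b)$. Write $E(f,\alpha)$ if $f=(e,1)$ with $\pi(e)=\alpha$. The two-sorted structure $Q_N$ is $(\mathcal H,\mathbb F)$. **General core formulas.** For $\ell\ge1$, $f,f',g\in\mathcal H$, $\alpha',b,\gamma\in\mathbb F$ let $\Lambda_\ell(f,f',g,\alpha',b,\gamma)$ say that there are $c_1,\dots,c_\ell\in\mathbb F$ with $c_i^2=\mathbf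 p(f)+i-1$ and $\prod_i c_i=b$, and that $E(g,\alpha')$, $\mathbf a^\ell f=bg$, $(\mathbf a^\dagger)^\ell g=bf$ and $g=\gamma f'$. Fix $k,m\ge 0$. A general core formula in the variables $e\in\mathcal H^k$, $a\in\mathbb F^m$ is given by: a division of the variables $e$ into $n$ and $r=k-n$ of them; a partition of the first $n$ into $s$ nonempty blocks, enumerating them as $e_{ij}$ $(1\le i\le s)$; canonical basis elements $h_1,\dots,h_t$ (that is, $E(h_j,\mathbf p(h_j))$) as parameters and an assignment of each of the other $r$ variables to some $h_i$, enumerating them as $e_{s+i,j}$ $(1\le i\le t)$, where an $h_i$ may have no variable assigned to it; sets $\Sigma\subseteq\{1..s\}^2$, $\Delta_1\subseteq\{1..s\}\times\{1..t\}$, $\Delta_2\subseteq\{1..t\}\times\{1..s\}$ with exponents $n_{(i,j)}\ge1$ for each of their elements; and a set $R\subseteq\mathbb F^q$, $q=s+2(|\Sigma|+|\Delta_1|+|\Delta_2|)+n+m+r$. It says that there are tuples $f\in\mathcal H^s$, $g,p,q$ from $\mathcal H$ indexed by $\Sigma,\Delta_1,\Delta_2$, and $\alpha,\gamma,\delta,\epsilon,b,m,o,\lambda,\mu$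 from $\mathbb F$ such that $E(f_i,\alpha_i)$ for all $i$; $e_{ij}=\lambda_{ij}f_i$ and $e_{s+i,j}=\mu_{ij}h_i$ for all $i,j$; $$\Lambda_{n_{(i,j)}}(f_i,f_j,g_{(i,j)},\alpha_j,b_{(i,j)},\gamma_{(i,j)})\ \text{ on }\Sigma,\qquad \Lambda_{n_{(i,j)}}(f_i,h_j,p_{(i,j)},\mathbf p(h_j),m_{(i,j)},\delta_{(i,j)})\ \text{ on }\Delta_1,$$ $$\Lambda_{n_{(i,j)}}(h_i,f_j,q_{(i,j)},\alpha_j,o_{(i,j)},\epsilon_{(i,j)})\ \text{ on }\Delta_2;$$ and $(\alpha,\gamma,\delta,\epsilon,b,m,o,\lambda,\mu,a)\in R$. The set $R$ is $\mathbb F[N]$-invariant if for every $\eta\in\mathbb F[N]^s$ it equals its preimage under the map of $\mathbb F^q$ that replaces $\gamma_{(i,j)}$ by $\eta_i\gamma_{(i,j)}\eta_j^{-1}$, $\delta_{(i,j)}$ by $\eta_i\delta_{(i,j)}$, $\epsilon_{(i,j)}$ by $\epsilon_{(i,j)}\eta_j^{-1}$, $\lambda_{ij}$ by $\lambda_{ij}\eta_i^{-1}$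 and fixes the other coordinates. **The topology.** A basic closed subset of $\mathcal H^k\times\mathbb F^m$ is a set defined by a general core formula over some $\mathbb F[N]$-invariant $R$ that is the solution set of a finite system of polynomial equations over $\mathbb F$. The closed sets are those generated from the basic closed sets by finite unions and arbitrary intersections. **Proposition.** The topology on $Q_N$ is Noetherian: for every such structure and all $k,m\ge0$, every descending chain of closed subsets of $\mathcal H^k\times\mathbb F^m$ stabilises. -/

import Mathlib

universe u v

/-- A model `QHO_N` of the theory `T_N` over the field `F`.  The projective line is
`OnePoint F = F ∪ {∞}` and `F[N]` is `rootsOfUnity N F`. -/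
structure QHO (N : ℕ) (F : Type u) [Field F] where
  /-- the cover of the projective line -/
  L : Type v
  /-- the projection to the projective line -/
  π : L → OnePoint F
  π_surjective : Function.Surjective π
  [act : MulAction (rootsOfUnity N F) L]
  /-- `F[N]` acts on each fibre, freely and transitively -/
  π_smul : ∀ (γ : rootsOfUnity N F) (e : L), π (γ • e) = π e
  free : ∀ (γ : rootsOfUnity N F) (e : L), γ • e = e → γ = 1
  trans : ∀ e e' : L, π e = π e' → ∃ γ : rootsOfUnity N F, γ • e = e'
  /-- the relation `𝐀` -/
  A : L → L → F → Prop
  /-- the relation `𝐀†` -/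
  Adag : L → L → F → Prop
  ladder : ∀ (a : F) (e : L), π e = (a : OnePoint F) →
    ∃ (b : F) (e' : L), π e' = ((a + 1 : F) : OnePoint F) ∧ b ^ 2 = a ∧
      ∀ γ : rootsOfUnity N F, A (γ • e) (γ • e') b ∧ Adag (γ • e') (γ • e) b
  A_even : Even N → ∀ (γ γ' : rootsOfUnity N F), (γ' : Fˣ) = -(γ : Fˣ) →
    ∀ e e' b, A e e' b → A (γ • e) (γ' • e') (-b)
  Adag_even : Even N → ∀ (γ γ' : rootsOfUnity N F), (γ' : Fˣ) = -(γ : Fˣ) →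
    ∀ e' e b, Adag e' e b → Adag (γ • e') (γ' • e) (-b)
  /-- `𝐚(e,1) := (e',b)` where `𝐀(e,e',b)` is a legitimate definition: over the affine line, the
  class of `(e',b)` is determined by `e`. -/
  A_wellDefined : ∀ (a : F) (e e₁ e₂ : L) (b₁ b₂ : F), π e = (a : OnePoint F) →
    A e e₁ b₁ → A e e₂ b₂ →
      ∃ γ : rootsOfUnity N F, γ • e₁ = e₂ ∧ ((γ⁻¹ : rootsOfUnity N F) : Fˣ) * b₁ = b₂
  /-- The same for `𝐚†(e',1) := (e,b)` where `𝐀†(e',e,b)`. -/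
  Adag_wellDefined : ∀ (a : F) (e e₁ e₂ : L) (b₁ b₂ : F), π e = (a : OnePoint F) →
    Adag e e₁ b₁ → Adag e e₂ b₂ →
      ∃ γ : rootsOfUnity N F, γ • e₁ = e₂ ∧ ((γ⁻¹ : rootsOfUnity N F) : Fˣ) * b₁ = b₂

namespace QHO

attribute [instance] QHO.act

section Bundle

variable {N : ℕ} {F : Type u} [Field F] (S : QHO.{u, v} N F)

/-- A point of `L` over a point `base` of the affine line. -/
structure AffPt where
  pt : S.L
  base : F
  π_pt : S.π pt = (base : OnePoint F)

/-- `(e,x) ∼ (e',x')` iff `γ e = e'` and `γ⁻¹ x = x'` for some `γ ∈ F[N]`.  By transitivity of the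
action on fibres this includes all the pairs with `π e = π e'` and `x = x' = 0`. -/
def bundleSetoid : Setoid (S.AffPt × F) where
  r p q := ∃ γ : rootsOfUnity N F,
    γ • p.1.pt = q.1.pt ∧ ((γ⁻¹ : rootsOfUnity N F) : Fˣ) * p.2 = q.2
  iseqv :=
    { refl := fun p => ⟨1, by simp, by simp⟩
      symm := by
        rintro p q ⟨γ, h1, h2⟩
        exact ⟨γ⁻¹, by rw [← h1, inv_smul_smul], by rw [← h2]; simp⟩
      trans := by
        rintro p q r ⟨γ, h1, h2⟩ ⟨γ', h3, h4⟩
        refine ⟨γ' * γ, by rw [mul_smul, h1, h3], ?_⟩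
        rw [← h4, ← h2]
        simp
        ring }

/-- The sort `𝓗 = ⋃ V_a` of `Q_N`, the union over `a ∈ F` of the lines
`V_a = {[(e,x)] : π e = a, x ∈ F}`. -/
def H : Type (max u v) := Quotient S.bundleSetoid

/-- The class of `(e,x)`. -/
def cls (e : S.AffPt) (x : F) : S.H := Quotient.mk S.bundleSetoid (e, x)

variable {S} in
theorem base_eq_of_rel {e e' : S.AffPt} {γ : rootsOfUnity N F} (h : γ • e.pt = e'.pt) :
    e.base = e'.base := by
  have h1 := S.π_smul γ e.pt
  rw [h, e.π_pt, e'.π_pt] at h1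
  exact (OnePoint.coe_injective h1).symm

/-- The projection `𝐩 : 𝓗 → F`. -/
def p : S.H → F :=
  Quotient.lift (fun q : S.AffPt × F => q.1.base) fun _ _ ⟨_, h, _⟩ => base_eq_of_rel h

/-- Scalar multiplication on the lines `V_a`: `c (e,x) = (e, c x)`. -/
instance : SMul F S.H where
  smul c := Quotient.map (fun q : S.AffPt × F => (q.1, c * q.2)) fun _ _ ⟨γ, h1, h2⟩ =>
    ⟨γ, h1, by dsimp only; rw [← h2]; ring⟩

/-- `E(f,α)`: `f` is a canonical basis element of the fibre over `α`, i.e. `f = (e,1)` with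
`π e = α`. -/
def E (f : S.H) (α : F) : Prop := ∃ e : S.AffPt, e.base = α ∧ f = S.cls e 1

theorem A_exists (e : S.AffPt) : ∃ q : S.AffPt × F, S.A e.pt q.1.pt q.2 := by
  obtain ⟨b, e', h1, -, h3⟩ := S.ladder e.base e.pt e.π_pt
  exact ⟨(⟨e', _, h1⟩, b), by simpa using (h3 1).1⟩

theorem Adag_exists (e : S.AffPt) : ∃ q : S.AffPt × F, S.Adag e.pt q.1.pt q.2 := by
  obtain ⟨e₀, h0⟩ := S.π_surjective ((e.base - 1 : F) : OnePoint F)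
  obtain ⟨b, e', h1, -, h3⟩ := S.ladder _ e₀ h0
  obtain ⟨γ, h4⟩ := S.trans e' e.pt (by rw [h1, e.π_pt, sub_add_cancel])
  exact ⟨(⟨γ • e₀, _, (S.π_smul γ e₀).trans h0⟩, b), by simpa [h4] using (h3 γ).2⟩

theorem A_equivariant {e e₁ e₂ : S.AffPt} {b₁ b₂ : F} {γ : rootsOfUnity N F}
    (h : γ • e.pt = e₂.pt) {e₃ : S.AffPt} (h1 : S.A e.pt e₁.pt b₁) (h2 : S.A e₂.pt e₃.pt b₂) :
    ∃ γ' : rootsOfUnity N F, γ' • e₁.pt = e₃.pt ∧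
      ((γ'⁻¹ : rootsOfUnity N F) : Fˣ) * (((γ : Fˣ) : F) * b₁) = b₂ := by
  obtain ⟨b, e', -, -, h5⟩ := S.ladder e.base e.pt e.π_pt
  have h6 := (h5 1).1
  rw [one_smul, one_smul] at h6
  have h7 := (h5 γ).1
  rw [h] at h7
  obtain ⟨γ₁, k1, k2⟩ := S.A_wellDefined _ _ _ _ _ _ e.π_pt h1 h6
  obtain ⟨γ₂, k3, k4⟩ := S.A_wellDefined _ _ _ _ _ _ e₂.π_pt h7 h2
  refine ⟨γ₂ * γ * γ₁, by rw [mul_smul, mul_smul, k1, k3], ?_⟩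
  rw [← k4, ← k2]
  simp
  ring_nf
  simp

theorem Adag_equivariant {e e₁ e₂ : S.AffPt} {b₁ b₂ : F} {γ : rootsOfUnity N F}
    (h : γ • e.pt = e₂.pt) {e₃ : S.AffPt} (h1 : S.Adag e.pt e₁.pt b₁)
    (h2 : S.Adag e₂.pt e₃.pt b₂) :
    ∃ γ' : rootsOfUnity N F, γ' • e₁.pt = e₃.pt ∧
      ((γ'⁻¹ : rootsOfUnity N F) : Fˣ) * (((γ : Fˣ) : F) * b₁) = b₂ := by
  obtain ⟨e₀, h0⟩ := S.π_surjective ((e.base - 1 : F) : OnePoint F)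
  obtain ⟨b, e', k0, -, h5⟩ := S.ladder _ e₀ h0
  obtain ⟨γ₀, h4⟩ := S.trans e' e.pt (by rw [k0, e.π_pt, sub_add_cancel])
  have h6 := (h5 γ₀).2
  rw [h4] at h6
  have h7 := (h5 (γ * γ₀)).2
  rw [mul_smul, h4, h, mul_smul] at h7
  obtain ⟨γ₁, k1, k2⟩ := S.Adag_wellDefined _ _ _ _ _ _ e.π_pt h1 h6
  obtain ⟨γ₂, k3, k4⟩ := S.Adag_wellDefined _ _ _ _ _ _ e₂.π_pt h7 h2
  refine ⟨γ₂ * γ * γ₁, by rw [mul_smul, mul_smul, k1, k3], ?_⟩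
  rw [← k4, ← k2]
  simp
  ring_nf
  simp

/-- The linear map `𝐚`, with `𝐚(e,x) = x 𝐚(e,1)` and `𝐚(e,1) = (e',b)` where `𝐀(e,e',b)`. -/
noncomputable def a : S.H → S.H :=
  Quotient.lift
    (fun q : S.AffPt × F =>
      S.cls (Classical.choose (S.A_exists q.1)).1 (q.2 * (Classical.choose (S.A_exists q.1)).2))
    (by
      rintro q q' ⟨γ, h1, h2⟩
      obtain ⟨γ', k1, k2⟩ := S.A_equivariant h1 (Classical.choose_spec (S.A_exists q.1))
        (Classical.choose_spec (S.A_exists q'.1))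
      refine Quotient.sound ⟨γ', k1, ?_⟩
      dsimp only
      rw [← k2, ← h2]
      simp
      field_simp)

/-- The linear map `𝐚†`, with `𝐚†(e',x) = x 𝐚†(e',1)` and `𝐚†(e',1) = (e,b)` where
`𝐀†(e',e,b)`. -/
noncomputable def adag : S.H → S.H :=
  Quotient.lift
    (fun q : S.AffPt × F =>
      S.cls (Classical.choose (S.Adag_exists q.1)).1
        (q.2 * (Classical.choose (S.Adag_exists q.1)).2))
    (by
      rintro q q' ⟨γ, h1, h2⟩
      obtain ⟨γ', k1, k2⟩ := S.Adag_equivariant h1 (Classical.choose_spec (S.Adag_exists q.1))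
        (Classical.choose_spec (S.Adag_exists q'.1))
      refine Quotient.sound ⟨γ', k1, ?_⟩
      dsimp only
      rw [← k2, ← h2]
      simp
      field_simp)

theorem a_cls {e e' : S.AffPt} {b : F} (h : S.A e.pt e'.pt b) (x : F) :
    S.a (S.cls e x) = S.cls e' (x * b) := by
  obtain ⟨γ', k1, k2⟩ := S.A_equivariant (one_smul _ e.pt)
    (Classical.choose_spec (S.A_exists e)) h
  refine Quotient.sound ⟨γ', k1, ?_⟩
  dsimp only
  rw [← k2]
  simp
  ring

theorem adag_cls {e e' : S.AffPt} {b : F} (h : S.Adag e.pt e'.pt b) (x : F) :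
    S.adag (S.cls e x) = S.cls e' (x * b) := by
  obtain ⟨γ', k1, k2⟩ := S.Adag_equivariant (one_smul _ e.pt)
    (Classical.choose_spec (S.Adag_exists e)) h
  refine Quotient.sound ⟨γ', k1, ?_⟩
  dsimp only
  rw [← k2]
  simp
  ring

/-- The block of `G^Σ`, `D₁` and `D₂` that belongs to one pair of indices: it links the basis
elements `f` and `f'`, the latter in the fibre over `α'`, through
`𝐚ⁿ f = b g`, `(𝐚†)ⁿ g = b f`, `g = γ f'`, where `g` is a canonical basis element of the fibre over
`α'` and `b` is a product of square roots of `𝐩 f, 𝐩 f + 1, …, 𝐩 f + (n - 1)`. -/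
def Link (n : ℕ) (f f' g : S.H) (α' b γ : F) : Prop :=
  (∃ c : Fin n → F, (∀ l : Fin n, c l ^ 2 = S.p f + (l : ℕ)) ∧ ∏ l, c l = b) ∧
    S.E g α' ∧ S.a^[n] f = b • g ∧ S.adag^[n] g = b • f ∧ g = γ • f'

end Bundle

/-- The combinatorial data of a general core formula with `k` free variables `e` from `𝓗`. -/
structure Shape (k : ℕ) where
  /-- `n` of the variables `e` are multiples of the quantified basis elements `f₁, …, f_s`;
  the other `r` are multiples of the parameters `h₁, …, h_t`. -/
  n : ℕ
  r : ℕ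
  s : ℕ
  t : ℕ
  vars : Fin n ⊕ Fin r ≃ Fin k
  /-- The partition of the first `n` variables into `s` nonempty blocks. -/
  block : Fin n → Fin s
  block_surjective : Function.Surjective block
  /-- The parameter to which each of the other `r` variables belongs. -/
  hblock : Fin r → Fin t
  Sig : Finset (Fin s × Fin s)
  Del₁ : Finset (Fin s × Fin t)
  Del₂ : Finset (Fin t × Fin s)
  /-- The exponents `n_(i,j)`. -/
  expSig : Sig → ℕ
  expDel₁ : Del₁ → ℕ
  expDel₂ : Del₂ → ℕ
  expSig_pos : ∀ x, 0 < expSig x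
  expDel₁_pos : ∀ x, 0 < expDel₁ x
  expDel₂_pos : ∀ x, 0 < expDel₂ x

/-- The coordinates `(α, γ, δ, ε, b, m, o, λ, μ, a)` of the affine space `F^q`,
`q = s + 2(|Σ| + |Δ₁| + |Δ₂|) + n + r + m`, in which `R` lives. -/
inductive Coord {k : ℕ} (D : Shape k) (m : ℕ) : Type
  | alpha (i : Fin D.s)
  | gamma (x : D.Sig)
  | delta (x : D.Del₁)
  | eps (x : D.Del₂)
  | b (x : D.Sig)
  | m (x : D.Del₁)
  | o (x : D.Del₂)
  | lam (v : Fin D.n)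
  | mu (v : Fin D.r)
  | a (j : Fin m)

section Topology

variable {N : ℕ} {F : Type u} [Field F]

/-- The transformation of the coordinates induced by the change `fᵢ ↦ ηᵢ fᵢ` of the basis elements,
for `η ∈ F[N]^s`:  `γ'_(i,j) = ηᵢ γ_(i,j) ηⱼ⁻¹`, `δ'_(i,j) = ηᵢ δ_(i,j)`, `ε'_(i,j) = ε_(i,j) ηⱼ⁻¹`,
`λ'_ij = λ_ij ηᵢ⁻¹`, the other coordinates being unchanged. -/
def twist {k m : ℕ} {D : Shape k} (η : Fin D.s → rootsOfUnity N F) (w : Coord D m → F) :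
    Coord D m → F
  | .alpha i => w (.alpha i)
  | .gamma x => ((η x.1.1 : Fˣ) : F) * w (.gamma x) * ((η x.1.2 : Fˣ) : F)⁻¹
  | .delta x => ((η x.1.1 : Fˣ) : F) * w (.delta x)
  | .eps x => w (.eps x) * ((η x.1.2 : Fˣ) : F)⁻¹
  | .b x => w (.b x)
  | .m x => w (.m x)
  | .o x => w (.o x)
  | .lam v => w (.lam v) * ((η (D.block v) : Fˣ) : F)⁻¹
  | .mu v => w (.mu v)
  | .a j => w (.a j)

/-- The Zariski closed set defined by a system of polynomial equations. -/
def solutions {ι : Type} (sys : Finset (MvPolynomial ι F)) : Set (ι → F) :=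
  {w | ∀ P ∈ sys, MvPolynomial.eval w P = 0}

/-- `R` is `F[N]`-invariant: `R^η = R` for all `η ∈ F[N]^s`, where `R^η = {w | η · w ∈ R}`.
(As `w ↦ η · w` is a linear automorphism of `F^q`, the set `R^η` is Zariski closed when `R` is, so
no closure has to be taken, and `R ↦ R^η` commutes with the decomposition into irreducible
components.) -/
def IsInvariant (N : ℕ) {k m : ℕ} {D : Shape k} (R : Set (Coord D m → F)) : Prop :=
  ∀ η : Fin D.s → rootsOfUnity N F, twist η ⁻¹' R = R

variable (S : QHO.{u, v} N F)

/-- The points `(e,a)` of `𝓗^k × F^m`, a product of the two sorts of `Q_N`. -/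
structure Point (k m : ℕ) where
  e : Fin k → S.H
  a : Fin m → F

/-- The set of the points `(e,a)` that satisfy the general core formula over `R` with parameters
`h`:  `∃ f g α γ δ ε b p q m o λ μ (A^Σ ∧ D₁ ∧ D₂ ∧ B ∧ R)`. -/
def coreSet {k m : ℕ} (D : Shape k) (h : Fin D.t → S.H) (R : Set (Coord D m → F)) :
    Set (S.Point k m) :=
  {x | ∃ (f : Fin D.s → S.H) (g : D.Sig → S.H) (p : D.Del₁ → S.H) (q : D.Del₂ → S.H)
      (w : Coord D m → F),
    -- `A^Σ(f,g,e,α,γ,b,λ)`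
    (∀ i, S.E (f i) (w (.alpha i))) ∧
    (∀ y : D.Sig, S.Link (D.expSig y) (f y.1.1) (f y.1.2) (g y) (w (.alpha y.1.2))
      (w (.b y)) (w (.gamma y))) ∧
    (∀ v : Fin D.n, x.e (D.vars (.inl v)) = w (.lam v) • f (D.block v)) ∧
    -- `D₁(f,p,h,m,δ)`
    (∀ y : D.Del₁, S.Link (D.expDel₁ y) (f y.1.1) (h y.1.2) (p y) (S.p (h y.1.2))
      (w (.m y)) (w (.delta y))) ∧
    -- `D₂(f,q,h,o,ε,α)`
    (∀ y : D.Del₂, S.Link (D.expDel₂ y) (h y.1.1) (f y.1.2) (q y) (w (.alpha y.1.2))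
      (w (.o y)) (w (.eps y))) ∧
    -- `B(e,h,μ)`
    (∀ v : Fin D.r, x.e (D.vars (.inr v)) = w (.mu v) • h (D.hblock v)) ∧
    -- `R(α,γ,δ,ε,b,m,o,λ,μ,a)`
    (∀ j, w (.a j) = x.a j) ∧ w ∈ R}

/-- The basic closed sets: those defined by general core formulas over `F[N]`-invariant systems of
polynomial equations, with canonical basis elements as parameters. -/
def IsBasicClosed {k m : ℕ} (X : Set (S.Point k m)) : Prop :=
  ∃ (D : Shape k) (h : Fin D.t → S.H) (sys : Finset (MvPolynomial (Coord D m) F)),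
    (∀ j, S.E (h j) (S.p (h j))) ∧ IsInvariant N (solutions sys) ∧
      X = S.coreSet D h (solutions sys)

/-- The topology of `Q_N` on `𝓗^k × F^m`: its closed sets are generated from the basic closed sets
by finite unions and arbitrary intersections. -/
instance (k m : ℕ) : TopologicalSpace (S.Point k m) :=
  TopologicalSpace.generateFrom {U | S.IsBasicClosed Uᶜ}

end Topology

end QHO

namespace QHO

/-! ### Coordinates on the fibres with respect to chosen basis elements -/

section Basis

variable {N : ℕ} {F : Type u} [Field F] (S : QHO.{u, v} N F)

/-! A space is Noetherian iff all its subsets are compact, so each ultrafilter `𝒰` containing `s`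
must converge to a point of `s`. It suffices that `𝒰`-almost every point lies in all the basic
closed sets that belong to `𝒰` (`eventually_mem_of_isBasicClosed`).

Choose a canonical basis element in each fibre and a square root of each product `α (α + 1) ⋯ (α + n
- 1)`. The witnesses of a core formula at a point are then determined up to finitely many roots of
unity and signs (`exists_coreAt`, `CoreAt.mem_coreSet`), and `𝒰` selects one such choice. The
exponents in `Σ` range over all positive integers, but `𝒰` also fixes these: a link forces the base
points to differ by the exponent, and two variables have at most one natural number as their
difference almost everywhere. So the witnesses for every basic closed set in `𝒰` are polynomials in
one finite list of functions, `regular`. These functions need not be algebraic: by Hilbert's basis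
theorem almost every point satisfies every polynomial relation that holds almost everywhere between
them. -/

theorem smul_cls (c : F) (e : S.AffPt) (x : F) : c • S.cls e x = S.cls e (c * x) := rfl

theorem p_cls (e : S.AffPt) (x : F) : S.p (S.cls e x) = e.base := rfl

theorem smul_smul_H (c d : F) (f : S.H) : c • d • f = (c * d) • f := by
  induction f using Quotient.inductionOn with
  | h q => exact congrArg (S.cls q.1) (mul_assoc c d q.2).symm

theorem p_smul (c : F) (f : S.H) : S.p (c • f) = S.p f := by
  induction f using Quotient.inductionOn with
  | h q => rfl

variable {S} in
theorem E.p_eq {f : S.H} {α : F} (h : S.E f α) : S.p f = α := by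
  obtain ⟨e, rfl, rfl⟩ := h
  rfl

variable {S} in
theorem E.smul {f : S.H} {α : F} (h : S.E f α) (γ : rootsOfUnity N F) :
    S.E (((γ : Fˣ) : F) • f) α := by
  obtain ⟨e, rfl, rfl⟩ := h
  refine ⟨⟨γ • e.pt, e.base, (S.π_smul γ e.pt).trans e.π_pt⟩, rfl, ?_⟩
  exact Quotient.sound ⟨γ, rfl, by simp⟩

theorem exists_E (α : F) : ∃ f, S.E f α := by
  obtain ⟨e, he⟩ := S.π_surjective (α : OnePoint F)
  exact ⟨_, ⟨e, α, he⟩, rfl, rfl⟩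

/-- A chosen canonical basis element of the fibre over `α`. -/
noncomputable def basis (α : F) : S.H := Classical.choose (S.exists_E α)

theorem E_basis (α : F) : S.E (S.basis α) α := Classical.choose_spec (S.exists_E α)

variable {S} in
theorem E.exists_eq_smul {f : S.H} {α : F} (h : S.E f α) :
    ∃ γ : rootsOfUnity N F, f = ((γ : Fˣ) : F) • S.basis α := by
  obtain ⟨e, rfl, rfl⟩ := h
  obtain ⟨e', h1, h2⟩ := S.E_basis e.base
  obtain ⟨γ, hγ⟩ := S.trans e.pt e'.pt (by rw [e.π_pt, e'.π_pt, h1])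
  refine ⟨γ⁻¹, ?_⟩
  rw [h2, smul_cls]
  exact Quotient.sound ⟨γ, hγ, by simp⟩

/-- Freeness of the action enters here: it makes each fibre a genuine line, so that `coord` is well
behaved. -/
theorem smul_basis_injective {α x y : F} (h : x • S.basis α = y • S.basis α) : x = y := by
  obtain ⟨e, -, he⟩ := S.E_basis α
  rw [he, smul_cls, smul_cls] at h
  obtain ⟨γ, h1, h2⟩ := Quotient.exact h
  obtain rfl := S.free γ e.pt h1
  simpa using h2

theorem exists_eq_smul_basis (f : S.H) : ∃ x : F, f = x • S.basis (S.p f) := by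
  induction f using Quotient.inductionOn with
  | h q =>
    obtain ⟨γ, hγ⟩ := E.exists_eq_smul (S := S) (f := S.cls q.1 1) (α := q.1.base) ⟨q.1, rfl, rfl⟩
    refine ⟨q.2 * ((γ : Fˣ) : F), ?_⟩
    rw [← smul_smul_H]
    change S.cls q.1 q.2 = q.2 • ((γ : Fˣ) : F) • S.basis q.1.base
    rw [← hγ, smul_cls, mul_one]

/-- The coordinate of `f` with respect to the chosen basis element of its fibre. -/
noncomputable def coord (f : S.H) : F := Classical.choose (S.exists_eq_smul_basis f)

theorem coord_smul_basis (f : S.H) : S.coord f • S.basis (S.p f) = f :=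
  (Classical.choose_spec (S.exists_eq_smul_basis f)).symm

variable {S} in
theorem coord_eq {f : S.H} {x α : F} (h : f = x • S.basis α) : S.coord f = x := by
  have h1 : S.p f = α := by rw [h, p_smul, (S.E_basis α).p_eq]
  apply S.smul_basis_injective (α := α)
  rw [← h, ← h1, coord_smul_basis]

theorem p_a (f : S.H) : S.p (S.a f) = S.p f + 1 := by
  induction f using Quotient.inductionOn with
  | h q =>
    obtain ⟨b, e', h1, -, h3⟩ := S.ladder q.1.base q.1.pt q.1.π_pt
    change S.p (S.a (S.cls q.1 q.2)) = q.1.base + 1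
    rw [S.a_cls (e' := ⟨e', _, h1⟩) (b := b) (by simpa using (h3 1).1), p_cls]

theorem p_iterate_a (n : ℕ) (f : S.H) : S.p (S.a^[n] f) = S.p f + n := by
  induction n with
  | zero => simp
  | succ n ih => rw [Function.iterate_succ_apply', p_a, ih]; push_cast; ring

-- Each `𝐚` raises the base point by one. This also holds when `b = 0`, since every fibre has its
-- own zero.
variable {S} in
theorem Link.p_eq {n : ℕ} {f f' g : S.H} {α' b γ : F} (h : S.Link n f f' g α' b γ) :
    α' = S.p f + n := by
  obtain ⟨-, h1, h2, -, -⟩ := h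
  rw [← p_iterate_a, h2, p_smul, h1.p_eq]

end Basis

/-! ### Links between chosen basis elements -/

section Normal

variable {N : ℕ} {F : Type u} [Field F] [IsAlgClosed F] (S : QHO.{u, v} N F)

theorem exists_sqrt_prod (n : ℕ) (α : F) :
    ∃ b : F, b ^ 2 = ∏ l : Fin n, (α + (l : ℕ)) :=
  IsAlgClosed.exists_pow_nat_eq _ two_pos

/-- A chosen square root of `α (α + 1) ⋯ (α + n - 1)`. -/
noncomputable def sqrtProd (n : ℕ) (α : F) : F := Classical.choose (exists_sqrt_prod n α)

theorem sqrtProd_sq (n : ℕ) (α : F) : sqrtProd n α ^ 2 = ∏ l : Fin n, (α + (l : ℕ)) :=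
  Classical.choose_spec (exists_sqrt_prod n α)

/-- The relation `Link` between the basis elements `η • basis α` and `η' • basis α'`, in terms of a
root of unity and of a sign. -/
def BasisLink (n : ℕ) (α α' : F) (η η' : rootsOfUnity N F) (z : rootsOfUnity N F × ℤˣ) : Prop :=
  S.Link n (((η : Fˣ) : F) • S.basis α) (((η' : Fˣ) : F) • S.basis α')
    (((z.1 : Fˣ) : F) • S.basis α') α' (((z.2 : ℤ) : F) * sqrtProd n α)
    (((z.1 : Fˣ) : F) / ((η' : Fˣ) : F))

variable {S} in
theorem BasisLink.eq_add {n : ℕ} {α α' : F} {η η' : rootsOfUnity N F}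
    {z : rootsOfUnity N F × ℤˣ} (h : S.BasisLink n α α' η η' z) : α' = α + n := by
  have h1 := Link.p_eq h
  rwa [p_smul, (S.E_basis α).p_eq] at h1

-- Only finitely many values are possible: `g` is a canonical basis element, hence a root of unity
-- times the chosen one, and `b ^ 2` is prescribed, so `b` is known up to sign.
variable {S} in
theorem Link.exists_basisLink {n : ℕ} {α α' b γ : F} {η η' : rootsOfUnity N F} {f f' g : S.H}
    (hf : f = ((η : Fˣ) : F) • S.basis α) (hf' : f' = ((η' : Fˣ) : F) • S.basis α')
    (h : S.Link n f f' g α' b γ) :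
    ∃ z : rootsOfUnity N F × ℤˣ, S.BasisLink n α α' η η' z ∧
      b = ((z.2 : ℤ) : F) * sqrtProd n α ∧ γ = ((z.1 : Fˣ) : F) / ((η' : Fˣ) : F) := by
  subst hf hf'
  have h0 := h
  obtain ⟨⟨c, h1, h2⟩, h3, -, -, h4⟩ := h
  obtain ⟨ζ, rfl⟩ := h3.exists_eq_smul
  have hγ : γ = ((ζ : Fˣ) : F) / ((η' : Fˣ) : F) := by
    rw [smul_smul_H] at h4
    rw [S.smul_basis_injective h4, mul_div_cancel_right₀ _ (Units.ne_zero _)]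
  have hb : b ^ 2 = sqrtProd n α ^ 2 := by
    rw [sqrtProd_sq, ← h2, ← Finset.prod_pow]
    refine Finset.prod_congr rfl fun l _ => ?_
    rw [h1, p_smul, (S.E_basis α).p_eq]
  obtain ⟨ε, hε⟩ : ∃ ε : ℤˣ, b = ((ε : ℤ) : F) * sqrtProd n α := by
    rcases sq_eq_sq_iff_eq_or_eq_neg.1 hb with h | h
    · exact ⟨1, by simp [h]⟩
    · exact ⟨-1, by simp [h]⟩
  refine ⟨(ζ, ε), ?_, hε, hγ⟩
  unfold BasisLink
  rwa [← hε, ← hγ]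

end Normal

/-! ### Normal form of core formulas -/

section Core

variable {N : ℕ} {F : Type u} [Field F] [IsAlgClosed F] (S : QHO.{u, v} N F)
variable {k m : ℕ} (D : Shape k)

/-- A variable belonging to the block of `fᵢ`. -/
noncomputable def Shape.rep (i : Fin D.s) : Fin k :=
  D.vars (.inl (Function.surjInv D.block_surjective i))

/-- The finitely many choices that determine the witnesses of a general core formula: the basis
elements of the fibres, and the signs of the square roots. -/
abbrev Choice (N : ℕ) (F : Type u) [Field F] : Type u :=
  (Fin D.s → rootsOfUnity N F) × (D.Sig → rootsOfUnity N F × ℤˣ) ×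
    (D.Del₁ → rootsOfUnity N F × ℤˣ) × (D.Del₂ → rootsOfUnity N F × ℤˣ)

variable {D}

/-- The witnesses in `F^q` of a general core formula at the point `x` that belong to a choice. -/
noncomputable def witness (h : Fin D.t → S.H) (θ : Fin D.t → rootsOfUnity N F)
    (c : Choice D N F) (x : S.Point k m) : Coord D m → F
  | .alpha i => S.p (x.e (D.rep i))
  | .gamma y => (((c.2.1 y).1 : Fˣ) : F) / ((c.1 y.1.2 : Fˣ) : F)
  | .delta y => (((c.2.2.1 y).1 : Fˣ) : F) / ((θ y.1.2 : Fˣ) : F)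
  | .eps y => (((c.2.2.2 y).1 : Fˣ) : F) / ((c.1 y.1.2 : Fˣ) : F)
  | .b y => (((c.2.1 y).2 : ℤ) : F) * sqrtProd (D.expSig y) (S.p (x.e (D.rep y.1.1)))
  -- The link to the parameter puts `fᵢ` over `𝐩 hⱼ - n`, so this coordinate does not depend on `x`.
  | .m y => (((c.2.2.1 y).2 : ℤ) : F) * sqrtProd (D.expDel₁ y) (S.p (h y.1.2) - D.expDel₁ y)
  | .o y => (((c.2.2.2 y).2 : ℤ) : F) * sqrtProd (D.expDel₂ y) (S.p (h y.1.1))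
  | .lam v => ((c.1 (D.block v) : Fˣ) : F)⁻¹ * S.coord (x.e (D.vars (.inl v)))
  | .mu v => ((θ (D.hblock v) : Fˣ) : F)⁻¹ * S.coord (x.e (D.vars (.inr v)))
  | .a j => x.a j

/-- The point `x` satisfies the general core formula with the witnesses that belong to a choice. -/
structure CoreAt (h : Fin D.t → S.H) (θ : Fin D.t → rootsOfUnity N F)
    (R : Set (Coord D m → F)) (c : Choice D N F) (x : S.Point k m) : Prop where
  block : ∀ v : Fin D.n, S.p (x.e (D.vars (.inl v))) = S.p (x.e (D.rep (D.block v)))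
  hblock : ∀ v : Fin D.r, S.p (x.e (D.vars (.inr v))) = S.p (h (D.hblock v))
  sig : ∀ y : D.Sig, S.BasisLink (D.expSig y) (S.p (x.e (D.rep y.1.1)))
    (S.p (x.e (D.rep y.1.2))) (c.1 y.1.1) (c.1 y.1.2) (c.2.1 y)
  del₁ : ∀ y : D.Del₁, S.BasisLink (D.expDel₁ y) (S.p (x.e (D.rep y.1.1)))
    (S.p (h y.1.2)) (c.1 y.1.1) (θ y.1.2) (c.2.2.1 y)
  del₂ : ∀ y : D.Del₂, S.BasisLink (D.expDel₂ y) (S.p (h y.1.1))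
    (S.p (x.e (D.rep y.1.2))) (θ y.1.1) (c.1 y.1.2) (c.2.2.2 y)
  mem : S.witness h θ c x ∈ R

variable {S} {h : Fin D.t → S.H} {θ : Fin D.t → rootsOfUnity N F} {R : Set (Coord D m → F)}

theorem CoreAt.mem_coreSet (hθ : ∀ j, h j = ((θ j : Fˣ) : F) • S.basis (S.p (h j)))
    {c : Choice D N F} {x : S.Point k m} (H : S.CoreAt h θ R c x) : x ∈ S.coreSet D h R := by
  refine ⟨fun i => ((c.1 i : Fˣ) : F) • S.basis (S.p (x.e (D.rep i))),
    fun y => (((c.2.1 y).1 : Fˣ) : F) • S.basis (S.p (x.e (D.rep y.1.2))),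
    fun y => (((c.2.2.1 y).1 : Fˣ) : F) • S.basis (S.p (h y.1.2)),
    fun y => (((c.2.2.2 y).1 : Fˣ) : F) • S.basis (S.p (x.e (D.rep y.1.2))),
    S.witness h θ c x, fun i => (S.E_basis _).smul _, H.sig, fun v => ?_, fun y => ?_, fun y => ?_,
    fun v => ?_, fun _ => rfl, H.mem⟩
  · have h1 := S.coord_smul_basis (x.e (D.vars (.inl v)))
    rw [H.block] at h1
    simp only [witness]
    rw [smul_smul_H, mul_right_comm, inv_mul_cancel₀ (Units.ne_zero _),
      one_mul, h1]
  · have h1 := H.del₁ y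
    have h2 := h1.eq_add
    rw [BasisLink, ← hθ] at h1
    simp only [witness]
    rwa [h2, add_sub_cancel_right, ← h2]
  · have h1 := H.del₂ y
    rw [BasisLink, ← hθ] at h1
    exact h1
  · have h1 := S.coord_smul_basis (x.e (D.vars (.inr v)))
    rw [H.hblock] at h1
    simp only [witness]
    rw [hθ (D.hblock v), smul_smul_H, mul_right_comm, inv_mul_cancel₀ (Units.ne_zero _),
      one_mul, h1]

theorem exists_coreAt (hθ : ∀ j, h j = ((θ j : Fˣ) : F) • S.basis (S.p (h j)))
    {x : S.Point k m} (hx : x ∈ S.coreSet D h R) : ∃ c, S.CoreAt h θ R c x := by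
  obtain ⟨f, g, p, q, w, hE, hS, hl, hd, hq, hm, ha, hR⟩ := hx
  have hv (v : Fin D.n) : w (.alpha (D.block v)) = S.p (x.e (D.vars (.inl v))) := by
    rw [hl, p_smul, (hE _).p_eq]
  -- As blocks are nonempty, the fibre of `fᵢ` can be read off from a free variable.
  have hα (i : Fin D.s) : w (.alpha i) = S.p (x.e (D.rep i)) := by
    rw [Shape.rep, ← hv, Function.surjInv_eq D.block_surjective]
  choose η hη using fun i => (hE i).exists_eq_smul
  simp only [hα] at hη hS hq
  choose z₀ z₀b z₀l z₀g using fun y => (hS y).exists_basisLink (hη _) (hη _)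
  choose z₁ z₁b z₁l z₁g using fun y => (hd y).exists_basisLink (hη _) (hθ _)
  choose z₂ z₂b z₂l z₂g using fun y => (hq y).exists_basisLink (hθ _) (hη _)
  have hw : S.witness h θ (η, z₀, z₁, z₂) x = w := by
    funext y
    cases y with
    | alpha i => exact (hα i).symm
    | gamma y => exact (z₀g y).symm
    | delta y => exact (z₁g y).symm
    | eps y => exact (z₂g y).symm
    | b y => exact (z₀l y).symm
    | m y =>
      simp only [witness]
      rw [(z₁b y).eq_add, add_sub_cancel_right, z₁l y]
    | o y => exact (z₂l y).symm
    | lam v =>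
      simp only [witness]
      have h1 := hl v
      rw [hη, smul_smul_H] at h1
      rw [coord_eq h1, mul_comm, mul_inv_cancel_right₀ (Units.ne_zero _)]
    | mu v =>
      simp only [witness]
      have h1 := hm v
      rw [hθ, smul_smul_H] at h1
      rw [coord_eq h1, mul_comm, mul_inv_cancel_right₀ (Units.ne_zero _)]
    | a j => exact (ha j).symm
  exact ⟨(η, z₀, z₁, z₂), fun v => by rw [← hv, hα], fun v => by rw [hm, p_smul], z₀b, z₁b, z₂b,
    by rwa [hw]⟩

end Core

/-! ### Convergence of ultrafilters -/

section Ultrafilter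

open Filter

theorem _root_.Ultrafilter.exists_eventually_of_finite {X ι : Type*} [Finite ι]
    (𝒰 : Ultrafilter X) {P : ι → X → Prop} (h : ∀ᶠ x in 𝒰, ∃ i, P i x) :
    ∃ i, ∀ᶠ x in 𝒰, P i x := by
  by_contra h1
  rw [not_exists] at h1
  have h2 : ∀ᶠ x in 𝒰, ∀ i, ¬ P i x :=
    eventually_all.2 fun i => Ultrafilter.eventually_not.2 (h1 i)
  obtain ⟨x, ⟨i, hi⟩, hx⟩ := (h.and h2).exists
  exact hx i hi

/-- The polynomials vanishing along `l` form an ideal; by Hilbert's basis theorem finitely many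
generators control all of them. The map `ψ` is arbitrary. -/
theorem _root_.Filter.eventually_forall_eventually_eval_eq_zero {X ι F : Type*} [Finite ι] [Field F]
    (l : Filter X) (ψ : X → ι → F) :
    ∀ᶠ x in l, ∀ P : MvPolynomial ι F, (∀ᶠ y in l, MvPolynomial.eval (ψ y) P = 0) →
      MvPolynomial.eval (ψ x) P = 0 := by
  let I : Ideal (MvPolynomial ι F) :=
    { carrier := {P | ∀ᶠ y in l, MvPolynomial.eval (ψ y) P = 0}
      add_mem' := fun hP hQ => by
        filter_upwards [hP, hQ] with y h1 h2
        rw [map_add, h1, h2, add_zero]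
      zero_mem' := by simp
      smul_mem' := fun c P hP => by
        filter_upwards [hP] with y h1
        rw [smul_eq_mul, map_mul, h1, mul_zero] }
  obtain ⟨s, hs⟩ := (isNoetherianRing_iff_ideal_fg _).1
    (inferInstance : IsNoetherianRing (MvPolynomial ι F)) I
  have h1 : ∀ᶠ x in l, ∀ P ∈ s, MvPolynomial.eval (ψ x) P = 0 :=
    (eventually_all_finset s).2 fun P hP => by
      have : P ∈ I := hs ▸ Ideal.subset_span hP
      exact this
  filter_upwards [h1] with x hx P hP
  have h2 : I ≤ RingHom.ker (MvPolynomial.eval (ψ x)) := by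
    rw [← hs, Ideal.span_le]
    exact hx
  exact h2 hP

variable {N : ℕ} {F : Type u} [Field F] [IsAlgClosed F] (S : QHO.{u, v} N F)
variable {k m : ℕ}

/-- The values at a point of the functions which are regular for the closed sets in an ultrafilter,
where `d v v'` is the difference of the base points of the variables `v'` and `v`. -/
noncomputable def regular (d : Fin k → Fin k → ℕ) (x : S.Point k m) :
    (Fin k ⊕ Fin k) ⊕ Fin m ⊕ Fin k × Fin k → F
  | .inl (.inl v) => S.p (x.e v)
  | .inl (.inr v) => S.coord (x.e v)
  | .inr (.inl j) => x.a j
  | .inr (.inr y) => sqrtProd (d y.1 y.2) (S.p (x.e y.1))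

open MvPolynomial in
/-- The coordinates of `witness` as polynomials in those of `regular`. -/
noncomputable def witnessPoly {D : Shape k} (h : Fin D.t → S.H) (θ : Fin D.t → rootsOfUnity N F)
    (c : Choice D N F) : Coord D m → MvPolynomial ((Fin k ⊕ Fin k) ⊕ Fin m ⊕ Fin k × Fin k) F
  | .alpha i => X (.inl (.inl (D.rep i)))
  | .gamma y => C ((((c.2.1 y).1 : Fˣ) : F) / ((c.1 y.1.2 : Fˣ) : F))
  | .delta y => C ((((c.2.2.1 y).1 : Fˣ) : F) / ((θ y.1.2 : Fˣ) : F))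
  | .eps y => C ((((c.2.2.2 y).1 : Fˣ) : F) / ((c.1 y.1.2 : Fˣ) : F))
  | .b y => C (((c.2.1 y).2 : ℤ) : F) * X (.inr (.inr (D.rep y.1.1, D.rep y.1.2)))
  | .m y => C ((((c.2.2.1 y).2 : ℤ) : F) *
      sqrtProd (D.expDel₁ y) (S.p (h y.1.2) - D.expDel₁ y))
  | .o y => C ((((c.2.2.2 y).2 : ℤ) : F) * sqrtProd (D.expDel₂ y) (S.p (h y.1.1)))
  | .lam v => C (((c.1 (D.block v) : Fˣ) : F)⁻¹) * X (.inl (.inr (D.vars (.inl v))))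
  | .mu v => C (((θ (D.hblock v) : Fˣ) : F)⁻¹) * X (.inl (.inr (D.vars (.inr v))))
  | .a j => X (.inr (.inl j))

theorem eval_witnessPoly {D : Shape k} {h : Fin D.t → S.H} {θ : Fin D.t → rootsOfUnity N F}
    {c : Choice D N F} {d : Fin k → Fin k → ℕ}
    (hd : ∀ y : D.Sig, d (D.rep y.1.1) (D.rep y.1.2) = D.expSig y) (x : S.Point k m)
    (y : Coord D m) :
    MvPolynomial.eval (S.regular d x) (S.witnessPoly h θ c y) = S.witness h θ c x y := by
  cases y <;> simp [witnessPoly, witness, regular, hd]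

/-- The point is uniformity: one set in `𝒰` serves all shapes, parameters and systems of equations
at once. -/
theorem eventually_mem_of_isBasicClosed [NeZero N] [CharZero F]
    (𝒰 : Ultrafilter (S.Point k m)) :
    ∀ᶠ x in 𝒰, ∀ X, S.IsBasicClosed X → X ∈ 𝒰 → x ∈ X := by
  obtain ⟨d, hd⟩ : ∃ d : Fin k → Fin k → ℕ, ∀ v v' (n : ℕ),
      (∀ᶠ x : S.Point k m in 𝒰, S.p (x.e v') = S.p (x.e v) + n) → d v v' = n := by
    have (v v' : Fin k) : ∃ d : ℕ, ∀ n : ℕ,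
        (∀ᶠ x : S.Point k m in 𝒰, S.p (x.e v') = S.p (x.e v) + n) → d = n := by
      by_cases h : ∃ n : ℕ, ∀ᶠ x : S.Point k m in 𝒰, S.p (x.e v') = S.p (x.e v) + n
      · obtain ⟨n, hn⟩ := h
        refine ⟨n, fun n' hn' => ?_⟩
        obtain ⟨x, h1, h2⟩ := (hn.and hn').exists
        exact_mod_cast add_left_cancel (h1.symm.trans h2)
      -- The default `0` is harmless: no link in `Σ` can hold almost everywhere between such
      -- variables.
      · exact ⟨0, fun n hn => (h ⟨n, hn⟩).elim⟩
    choose d hd using this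
    exact ⟨d, hd⟩
  have hpoly := eventually_forall_eventually_eval_eq_zero (𝒰 : Filter (S.Point k m)) (S.regular d)
  -- Links need not be polynomial conditions, but with the exponents fixed by `d` there are only
  -- finitely many to consider.
  have hlink : ∀ᶠ x : S.Point k m in 𝒰, ∀ i : (Fin k × Fin k) × (rootsOfUnity N F × rootsOfUnity N F) ×
      (rootsOfUnity N F × ℤˣ),
      (∀ᶠ y : S.Point k m in 𝒰, S.BasisLink (d i.1.1 i.1.2) (S.p (y.e i.1.1)) (S.p (y.e i.1.2)) i.2.1.1 i.2.1.2
        i.2.2) →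
      S.BasisLink (d i.1.1 i.1.2) (S.p (x.e i.1.1)) (S.p (x.e i.1.2)) i.2.1.1 i.2.1.2 i.2.2 := by
    refine eventually_all.2 fun i => ?_
    by_cases h : ∀ᶠ y : S.Point k m in 𝒰, S.BasisLink (d i.1.1 i.1.2) (S.p (y.e i.1.1)) (S.p (y.e i.1.2))
      i.2.1.1 i.2.1.2 i.2.2
    · filter_upwards [h] with x hx _ using hx
    · exact Eventually.of_forall fun x hx => (h hx).elim
  filter_upwards [hpoly, hlink] with x hx hxl
  rintro _ ⟨D, h, sys, hh, -, rfl⟩ hmem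
  choose θ hθ using fun j => (hh j).exists_eq_smul
  obtain ⟨c, hc⟩ := 𝒰.exists_eventually_of_finite (P := fun c x => S.CoreAt h θ (solutions sys) c x)
    (mem_of_superset hmem fun y hy => exists_coreAt hθ hy)
  have heq (v v' : Fin k) (H : ∀ᶠ y : S.Point k m in 𝒰, S.p (y.e v) = S.p (y.e v')) :
      S.p (x.e v) = S.p (x.e v') := by
    have := hx (.X (.inl (.inl v)) - .X (.inl (.inl v')))
      (H.mono fun y hy => by simp [regular, hy])
    simpa [regular, sub_eq_zero] using this
  have hconst (v : Fin k) (α : F) (H : ∀ᶠ y : S.Point k m in 𝒰, S.p (y.e v) = α) : S.p (x.e v) = α := by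
    have := hx (.X (.inl (.inl v)) - .C α) (H.mono fun y hy => by simp [regular, hy])
    simpa [regular, sub_eq_zero] using this
  have hdS (y : D.Sig) : d (D.rep y.1.1) (D.rep y.1.2) = D.expSig y :=
    hd _ _ _ (hc.mono fun x hx => (hx.sig y).eq_add)
  refine CoreAt.mem_coreSet hθ (c := c) ⟨fun v => heq _ _ (hc.mono fun y hy => hy.block v),
    fun v => hconst _ _ (hc.mono fun y hy => hy.hblock v), fun y => ?_, fun y => ?_, fun y => ?_,
    fun P hP => ?_⟩
  · rw [← hdS]
    refine hxl ((D.rep y.1.1, D.rep y.1.2), (_, _), _) (hc.mono fun z hz => ?_)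
    dsimp only
    rw [hdS]
    exact hz.sig y
  · obtain ⟨z, hz⟩ := hc.exists
    -- A link with a parameter makes the base point constant almost everywhere, so the link at `z`
    -- is the link at `x`.
    rw [hconst (D.rep y.1.1) (S.p (z.e (D.rep y.1.1)))]
    · exact hz.del₁ y
    · exact hc.mono fun z' hz' => add_right_cancel
        ((hz'.del₁ y).eq_add.symm.trans (hz.del₁ y).eq_add)
  · obtain ⟨z, hz⟩ := hc.exists
    rw [hconst (D.rep y.1.2) (S.p (z.e (D.rep y.1.2)))]
    · exact hz.del₂ y
    · exact hc.mono fun z' hz' => (hz'.del₂ y).eq_add.trans (hz.del₂ y).eq_add.symm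
  · have key (z : S.Point k m) : MvPolynomial.eval (S.regular d z)
        (MvPolynomial.bind₁ (S.witnessPoly h θ c) P) =
        MvPolynomial.eval (S.witness h θ c z) P := by
      rw [← funext (S.eval_witnessPoly hdS z)]
      exact MvPolynomial.eval₂Hom_bind₁ _ _ _ _
    rw [← key]
    exact hx _ (hc.mono fun z hz => by rw [key]; exact hz.mem P hP)

end Ultrafilter

end QHO

theorem mainTheorem7 {F : Type u} [Field F] [IsAlgClosed F] [CharZero F] (N : ℕ) (hN : 0 < N)
    (S : QHO.{u, v} N F) (k m : ℕ) :
    TopologicalSpace.NoetherianSpace (S.Point k m) := by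
  have : NeZero N := ⟨hN.ne'⟩
  refine ((TopologicalSpace.noetherianSpace_TFAE _).out 0 2).2 fun s => ?_
  refine isCompact_iff_ultrafilter_le_nhds.2 fun 𝒰 h𝒰 => ?_
  obtain ⟨x, hx, hxs⟩ := ((S.eventually_mem_of_isBasicClosed 𝒰).and
    (Filter.le_principal_iff.1 h𝒰)).exists
  refine ⟨x, hxs, ?_⟩
  rw [TopologicalSpace.nhds_generateFrom]
  refine le_iInf₂ fun U ⟨hxU, hU⟩ => Filter.le_principal_iff.2 ?_
  -- If `U` is not in `𝒰`, its basic closed complement is, and must then contain `x`.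
  by_contra h
  exact hx _ hU (Ultrafilter.compl_mem_iff_notMem.2 h) hxU
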